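/- Let $N\ge 2$ and let $P$ and $Q=P+E$ be transition matrices of symmetric ergodic (irreducible and aperiodic) Markov chains on a set $X$ of $N$ elements; being symmetric, the chains are reversible. Let $\|E\|$ be the $\ell_2$ operator norm of $E$, and let $\lambda_2(\cdot)$ denote the second largest eigenvalue, counted with multiplicity. Let $M\subseteq X$ be a non-empty set of marked elements, $|M|=\epsilon N$. For such a chain $P$ let $\tilde P$ be the chain obtained from $P$ by making the marked elements absorbing ($\tilde p_{xy}=p_{xy}$ for $x\notin M$, and $\tilde p_{xy}=\delta_{xy}$, the Kronecker symbol, for $x\in M$). Let $W(\tilde P)=(2\Pi_B-I)(2\Pi_A-I)$ be the Szegedy walk operator on $\mathbb C^X\otimes\mathbb C^X$, where $\Pi_A$ and $\Pi_B$ are the orthogonal projections onto the spans of the vectors $|x\rangle\otimes\sum_{y}\sqrt{\tilde p_{xy}}\,|y\rangle$ $(x\in X)$ and of the vectors $\sum_{x}\sqrt{\tilde p_{yx}}\,|x\rangle\otimes|y\rangle$ $(y\in X)$, respectively. Put $|\phi_0\rangle=\frac1{\sqrt N}\sum_{x,y}\sqrt{p_{xy}}\,|x\rangle|y\rangle$.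 The quantum hitting time $HT(P)$ (of the set $M$) is the least integer $T\ge 0$ such that $$\frac1{T+1}\sum_{t=0}^{T}\bigl\|W(\tilde P)^t|\phi_0\rangle-|\phi_0\rangle\bigr\|^2\ \ge\ 1-\frac{|M|}{N},$$ and $HT(Q)$ is defined in the same way from $Q$. Let $\delta>0$ and $\Delta$ be real numbers with $\lambda_2(P)\le 1-\delta$ and $\lambda_2(Q)\le 1-\Delta$. Then $HT(P)$ is finite and $$HT(P)=O\Bigl(\sqrt{\tfrac{1}{\delta\epsilon}}\Bigr),$$ and if $\|E\|<\delta$, then $HT(Q)$ is finite and $$HT(Q)=O\Bigl(\sqrt{\tfrac{1}{(\delta-\|E\|)\,\epsilon}}\Bigr),$$ where the constants in $O(\cdot)$ are absolute. Moreover, $\delta-\|E\|\le\Delta$ if $\Delta=1-\lambda_2(Q)$ is the spectral gap of $Q$, and $\Delta\le\delta+\|E\|$ if $\delta=1-\lambda_2(P)$ is the spectral gap of $P$; in particular $\delta-\|E\|\le\Delta\le\delta+\|E\|$ when $\delta$ and $\Delta$ are the spectral gaps. -/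

import Mathlib

-- `‖E‖` for a matrix `E` is the operator norm induced by the Euclidean norm.
open scoped Matrix.Norms.L2Operator

noncomputable section

namespace QuantumWalk

/-- A symmetric ergodic Markov chain on the finite set `X`, given by its transition matrix
(`P x y` is the probability of the transition `x → y`): a symmetric stochastic matrix some power
of which is entrywise positive, i.e. an irreducible and aperiodic chain.
Symmetry is detailed balance for the uniform distribution, so such a chain is reversible. -/
structure IsSymmErgodicChain {X : Type*} [Fintype X] [DecidableEq X] (P : Matrix X X ℝ) :
    Prop where
  stochastic : P ∈ Matrix.rowStochastic ℝ X
  symm : P.IsSymm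
  ergodic : P.IsPrimitive

theorem IsSymmErgodicChain.isHermitian {X : Type*} [Fintype X] [DecidableEq X]
    {P : Matrix X X ℝ} (hP : IsSymmErgodicChain P) : P.IsHermitian :=
  Matrix.isHermitian_iff_isSymm.2 hP.symm

/-- The second largest eigenvalue `λ₂`, counted with multiplicity, of a symmetric real matrix of
size `N ≥ 2` (`eigenvalues₀` lists the eigenvalues in decreasing order, starting at index `0`). -/
def secondEigenvalue {N : ℕ} (hN : 1 < N) {A : Matrix (Fin N) (Fin N) ℝ} (hA : A.IsHermitian) :
    ℝ :=
  hA.eigenvalues₀ ⟨1, by simpa using hN⟩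

/-- The state space `ℂ^X ⊗ ℂ^X` of the walk, with orthonormal basis `|x⟩|y⟩`. -/
abbrev StateSpace (X : Type*) [Fintype X] : Type _ := EuclideanSpace ℂ (X × X)

/-- `|x⟩ ⊗ ∑ y, √(P x y) |y⟩`. -/
def rowState {X : Type*} [Fintype X] [DecidableEq X] (P : Matrix X X ℝ) (x : X) : StateSpace X :=
  WithLp.toLp 2 fun z => if z.1 = x then (√(P x z.2) : ℂ) else 0

/-- `(∑ x, √(P y x) |x⟩) ⊗ |y⟩`. -/
def colState {X : Type*} [Fintype X] [DecidableEq X] (P : Matrix X X ℝ) (y : X) : StateSpace X :=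
  WithLp.toLp 2 fun z => if z.2 = y then (√(P y z.1) : ℂ) else 0

/-- Szegedy's walk operator `W(P) = (2 Π_B - 1) (2 Π_A - 1)` of a Markov chain `P`, where `Π_A`
and `Π_B` are the orthogonal projections onto the spans of the row states and of the column
states. -/
def walk {X : Type*} [Fintype X] [DecidableEq X] (P : Matrix X X ℝ) :
    StateSpace X ≃ₗᵢ[ℂ] StateSpace X :=
  (Submodule.span ℂ (Set.range (colState P))).reflection *
    (Submodule.span ℂ (Set.range (rowState P))).reflection

/-- The modified chain, in which the marked elements are made absorbing. -/
def absorbing {X : Type*} [DecidableEq X] (P : Matrix X X ℝ) (M : Finset X) : Matrix X X ℝ :=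
  Matrix.of fun x y => if x ∈ M then (if x = y then 1 else 0) else P x y

/-- The initial state `N^(-1/2) ∑ x y, √(P x y) |x⟩|y⟩`, with `N` the number of elements. -/
def initialState {X : Type*} [Fintype X] (P : Matrix X X ℝ) : StateSpace X :=
  WithLp.toLp 2 fun z => (√(P z.1 z.2 / Fintype.card X) : ℂ)

/-- The average over `0 ≤ t ≤ T` of `‖W^t φ - φ‖²`, where `φ` is the initial state of the chain
`P` and `W` is the walk operator of the modified chain. -/
def meanDeviation {X : Type*} [Fintype X] [DecidableEq X] (P : Matrix X X ℝ) (M : Finset X)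
    (T : ℕ) : ℝ :=
  (∑ t ∈ Finset.range (T + 1),
    ‖(walk (absorbing P M) ^ t) (initialState P) - initialState P‖ ^ 2) / (T + 1)

/-- Szegedy's quantum hitting time of the marked set `M`: the least `T` for which the mean
deviation is at least `1 - |M| / N` (and `⊤` if there is no such `T`). -/
def hittingTime {X : Type*} [Fintype X] [DecidableEq X] (P : Matrix X X ℝ) (M : Finset X) : ℕ∞ :=
  ⨅ (T : ℕ) (_ : 1 - (M.card : ℝ) / Fintype.card X ≤ meanDeviation P M T), (T : ℕ∞)

end QuantumWalk

end

/-! Let `A`, `B` be the spans of the unmarked row and column states and `C` the span of the states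
|x⟩|x⟩ with x marked. Since `C` is orthogonal to `A` and `B`, the walk `U` is the product of the
reflections in `A ⊔ C` and `B ⊔ C`. It fixes the complement of `A ⊔ B` pointwise. On `A ⊔ B` it
satisfies ‖v - Uv‖ = 2‖Π_A v - Π_B v‖ ≥ 2√g‖v‖ as soon as inner products between `A` and `B` are at
most 1 - g times the product of the norms (`le_norm_sq_starProjection_sub`).

Hence the component ψ of the initial state in `A ⊔ B` is χ - Uχ with ‖χ‖ ≤ ‖ψ‖/(2√g). The sum of the
Uᵗψ telescopes, so no phase estimation or eigenvalue analysis of `U` is needed: after 2/√g terms the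
mean deviation is at least ‖ψ‖², which is at least 1 - |M|/N, the squared norm of the unmarked part
of the initial state.

Inner products between `A` and `B` are given by the unmarked block of `P`. Its norm is at most 1 -
δε, by the spectral gap and Cauchy-Schwarz (`dotProduct_mulVec_le_of_eq_zero_on`), so g = δε and the
constant is 2. For `Q`, Weyl's inequality supplies the gap δ - ‖E‖. -/

namespace QuantumWalk

/-! ### Ergodic averages of an isometry. -/

section Powers

variable {H : Type*} [NormedAddCommGroup H] [InnerProductSpace ℂ H]

/-- An average of `U ^ t` over a coboundary telescopes. -/
theorem sum_range_pow_apply_sub (U : H ≃ₗᵢ[ℂ] H) (χ : H) (n : ℕ) :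
    ∑ t ∈ Finset.range n, (U ^ t) (χ - U χ) = χ - (U ^ n) χ := by
  induction n with
  | zero => simp
  | succ n ih =>
    rw [Finset.sum_range_succ, ih, map_sub, pow_succ, LinearIsometryEquiv.coe_mul, Function.comp_apply]
    abel

/-- A coboundary with a small primitive moves far from itself on average. -/
theorem le_sum_norm_sq_pow_apply_sub (U : H ≃ₗᵢ[ℂ] H) {χ : H} {n : ℕ}
    (hn : 4 * ‖χ‖ ≤ n * ‖χ - U χ‖) :
    n * ‖χ - U χ‖ ^ 2 ≤ ∑ t ∈ Finset.range n, ‖(U ^ t) (χ - U χ) - (χ - U χ)‖ ^ 2 := by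
  set ψ := χ - U χ with hψ
  have h1 : ∀ t, ‖(U ^ t) ψ - ψ‖ ^ 2 = 2 * ‖ψ‖ ^ 2 - 2 * RCLike.re (inner ℂ ((U ^ t) ψ) ψ) := by
    intro t
    rw [norm_sub_sq (𝕜 := ℂ), LinearIsometryEquiv.norm_map]; ring
  -- The telescoped sum has norm at most 2‖χ‖ ≤ n‖ψ‖/2, so the cross terms cancel at most half of
  -- 2n‖ψ‖².
  have h2 : ∑ t ∈ Finset.range n, RCLike.re (inner ℂ ((U ^ t) ψ) ψ) ≤ n * ‖ψ‖ ^ 2 / 2 := by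
    rw [← map_sum, ← sum_inner, hψ, sum_range_pow_apply_sub, ← hψ]
    calc RCLike.re (inner ℂ (χ - (U ^ n) χ) ψ) ≤ ‖χ - (U ^ n) χ‖ * ‖ψ‖ := re_inner_le_norm _ _
      _ ≤ (‖χ‖ + ‖χ‖) * ‖ψ‖ := by
        gcongr
        simpa using norm_sub_le χ ((U ^ n) χ)
      _ ≤ n * ‖ψ‖ ^ 2 / 2 := by nlinarith [mul_le_mul_of_nonneg_right hn (norm_nonneg ψ)]
  simp only [h1, Finset.sum_sub_distrib, ← Finset.mul_sum, Finset.sum_const, Finset.card_range,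
    nsmul_eq_mul]
  linarith

theorem pow_apply_eq_self (U : H ≃ₗᵢ[ℂ] H) {f : H} (hf : U f = f) (t : ℕ) : (U ^ t) f = f := by
  induction t with
  | zero => simp
  | succ t ih => rw [pow_succ, LinearIsometryEquiv.coe_mul, Function.comp_apply, hf, ih]

end Powers

/-! ### Products of two reflections. -/

section Reflections

variable {H : Type*} [NormedAddCommGroup H] [InnerProductSpace ℂ H] [FiniteDimensional ℂ H]
  {A B C : Submodule ℂ H}

/-- Adding to `A` a subspace orthogonal to `A` and to `v` does not change the projection of `v`. -/
theorem starProjection_sup_of_isOrtho (hAC : A ⟂ C) {v : H} (hv : v ∈ Cᗮ) :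
    (A ⊔ C).starProjection v = A.starProjection v := by
  refine Submodule.eq_starProjection_of_mem_orthogonal
    (le_sup_left (a := A) (b := C) (A.starProjection_apply_mem v)) ?_
  rw [← Submodule.inf_orthogonal]
  exact ⟨A.sub_starProjection_mem_orthogonal v,
    sub_mem hv (hAC (A.starProjection_apply_mem v))⟩

theorem norm_sq_sub_starProjection_add (A : Submodule ℂ H) (v : H) :
    ‖v - A.starProjection v‖ ^ 2 + ‖A.starProjection v‖ ^ 2 = ‖v‖ ^ 2 := by
  have h := norm_add_sq_eq_norm_sq_add_norm_sq_of_inner_eq_zero (𝕜 := ℂ)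
    (v - A.starProjection v) (A.starProjection v)
    (A.starProjection_inner_eq_zero v _ (A.starProjection_apply_mem v))
  rw [sub_add_cancel] at h
  nlinarith [h]

/-- If inner products between `A` and `B` are bounded away from the maximal ones, then a vector of
`A` is far from `B`. -/
theorem le_norm_sq_sub_starProjection {g : ℝ} (hg0 : 0 ≤ g)
    (h : ∀ a ∈ A, ∀ b ∈ B, ‖inner ℂ a b‖ ≤ (1 - g) / 2 * (‖a‖ ^ 2 + ‖b‖ ^ 2))
    {a : H} (ha : a ∈ A) : g * ‖a‖ ^ 2 ≤ ‖a - B.starProjection a‖ ^ 2 := by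
  have h1 := h a ha _ (B.starProjection_apply_mem a)
  have h2 : inner ℂ a (B.starProjection a) = (‖B.starProjection a‖ : ℂ) ^ 2 := by
    have := B.starProjection_inner_eq_zero a _ (B.starProjection_apply_mem a)
    rw [inner_sub_left, sub_eq_zero] at this
    rw [this, inner_self_eq_norm_sq_to_K]; rfl
  rw [h2, norm_pow, Complex.norm_real, norm_norm] at h1
  have h3 := norm_sq_sub_starProjection_add B a
  -- `h1` rearranges to (1 + g)‖Π_B a‖² ≤ (1 - g)‖a‖².
  have h4 : ‖B.starProjection a‖ ^ 2 ≤ (1 - g) * ‖a‖ ^ 2 := by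
    nlinarith [mul_nonneg hg0 (sq_nonneg ‖B.starProjection a‖)]
  linarith

/-- On `A ⊔ B`, the difference of the projections onto `A` and `B` is bounded below. -/
theorem le_norm_sq_starProjection_sub {g : ℝ} (hg0 : 0 ≤ g)
    (h : ∀ a ∈ A, ∀ b ∈ B, ‖inner ℂ a b‖ ≤ (1 - g) / 2 * (‖a‖ ^ 2 + ‖b‖ ^ 2))
    {v : H} (hv : v ∈ A ⊔ B) :
    g * ‖v‖ ^ 2 ≤ ‖A.starProjection v - B.starProjection v‖ ^ 2 := by
  have hsymm : ∀ b ∈ B, ∀ a ∈ A, ‖inner ℂ b a‖ ≤ (1 - g) / 2 * (‖b‖ ^ 2 + ‖a‖ ^ 2) := by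
    intro b hb a ha
    rw [norm_inner_symm, add_comm]; exact h a ha b hb
  set a := A.starProjection v with ha_def
  have haA : a ∈ A := A.starProjection_apply_mem v
  -- the part of `v` orthogonal to `A`
  set v' := v - a with hv'
  obtain ⟨b, hbB, hb⟩ : ∃ b ∈ B, v' = b - A.starProjection b := by
    obtain ⟨a₁, ha₁, b, hb, rfl⟩ := Submodule.mem_sup.1 hv
    refine ⟨b, hb, ?_⟩
    rw [hv', ha_def, map_add, Submodule.starProjection_eq_self_iff.2 ha₁]
    abel
  have hv'A : v' ∈ Aᗮ := A.sub_starProjection_mem_orthogonal v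
  -- The two summands lie in Bᗮ and B, so their squared norms add and can be compared separately
  -- with ‖a‖² and ‖v'‖².
  have hsplit : a - B.starProjection v = (a - B.starProjection a) + -B.starProjection v' := by
    rw [hv', map_sub]; abel
  have horth : inner ℂ (a - B.starProjection a) (-B.starProjection v') = 0 :=
    B.starProjection_inner_eq_zero a _ (neg_mem (B.starProjection_apply_mem v'))
  have hpyth := norm_add_sq_eq_norm_sq_add_norm_sq_of_inner_eq_zero _ _ horth
  have hnorm := norm_sq_sub_starProjection_add A v
  have h1 := le_norm_sq_sub_starProjection hg0 h haA
  have h2 := le_norm_sq_sub_starProjection hg0 hsymm hbB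
  have h3 : ‖v'‖ ^ 2 ≤ ‖B.starProjection v'‖ * ‖b‖ := by
    have e1 : inner ℂ v' b = (‖v'‖ : ℂ) ^ 2 := by
      have : inner ℂ v' (A.starProjection b) = 0 := by
        rw [← inner_conj_symm, hv'A _ (A.starProjection_apply_mem b), map_zero]
      rw [← sub_zero (inner ℂ v' b), ← this, ← inner_sub_right, ← hb,
        inner_self_eq_norm_sq_to_K]; rfl
    have e2 : inner ℂ (B.starProjection v') b = inner ℂ v' b := by
      have := B.starProjection_inner_eq_zero v' b hbB
      rw [inner_sub_left, sub_eq_zero] at this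
      exact this.symm
    have := norm_inner_le_norm (𝕜 := ℂ) (B.starProjection v') b
    rwa [e2, e1, norm_pow, Complex.norm_real, norm_norm] at this
  rw [← hb] at h2
  -- Combine ‖v'‖⁴ ≤ ‖Π_B v'‖²‖b‖² from `h3` with g‖b‖² ≤ ‖v'‖² from `h2`, then cancel ‖v'‖².
  have h4 : g * ‖v'‖ ^ 2 ≤ ‖B.starProjection v'‖ ^ 2 := by
    rcases (norm_nonneg v').eq_or_lt with h0 | h0
    · rw [← h0]; nlinarith [sq_nonneg ‖B.starProjection v'‖]
    · have h5 : (‖v'‖ ^ 2) ^ 2 ≤ ‖B.starProjection v'‖ ^ 2 * ‖b‖ ^ 2 := by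
        rw [← mul_pow]; gcongr
      have h6 : g * (‖v'‖ ^ 2) ^ 2 ≤ ‖B.starProjection v'‖ ^ 2 * ‖v'‖ ^ 2 := by
        nlinarith [mul_le_mul_of_nonneg_left h5 hg0,
          mul_le_mul_of_nonneg_left h2 (sq_nonneg ‖B.starProjection v'‖)]
      have h7 : 0 < ‖v'‖ ^ 2 := by positivity
      refine le_of_mul_le_mul_right ?_ h7
      nlinarith
  rw [hsplit, pow_two ‖_ + _‖, hpyth, norm_neg]
  nlinarith

/-- On such f both reflections act as 2Π_C - 1, whose square is the identity. -/
theorem reflection_mul_reflection_apply_of_mem_orthogonal (hAC : A ⟂ C) (hBC : B ⟂ C) {f : H}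
    (hf : f ∈ (A ⊔ B)ᗮ) : ((B ⊔ C).reflection * (A ⊔ C).reflection) f = f := by
  rw [← Submodule.inf_orthogonal] at hf
  have key : ∀ {K : Submodule ℂ H}, K ⟂ C → f ∈ Kᗮ →
      (K ⊔ C).starProjection f = C.starProjection f := by
    intro K hK hf'
    simp_rw [sup_comm K C]
    exact starProjection_sup_of_isOrtho hK.symm hf'
  have h : (A ⊔ C).reflection f = (B ⊔ C).reflection f := by
    rw [Submodule.reflection_apply, Submodule.reflection_apply, key hAC hf.1, key hBC hf.2]
  rw [LinearIsometryEquiv.coe_mul, Function.comp_apply, h, Submodule.reflection_reflection]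

theorem reflection_sup_mem (hAC : A ⟂ C) {V : Submodule ℂ H} (hAV : A ≤ V) (hVC : V ≤ Cᗮ)
    {v : H} (hv : v ∈ V) : (A ⊔ C).reflection v ∈ V := by
  rw [Submodule.reflection_apply, starProjection_sup_of_isOrtho hAC (hVC hv)]
  exact sub_mem (V.smul_of_tower_mem 2 (hAV (A.starProjection_apply_mem v))) hv

theorem reflection_mul_reflection_apply_mem (hAC : A ⟂ C) (hBC : B ⟂ C) {v : H}
    (hv : v ∈ A ⊔ B) : ((B ⊔ C).reflection * (A ⊔ C).reflection) v ∈ A ⊔ B := by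
  have hVC : A ⊔ B ≤ Cᗮ := sup_le hAC hBC
  exact reflection_sup_mem hBC le_sup_right hVC (reflection_sup_mem hAC le_sup_left hVC hv)

theorem le_norm_sq_sub_reflection_mul_reflection (hAC : A ⟂ C) (hBC : B ⟂ C) {g : ℝ} (hg0 : 0 ≤ g)
    (h : ∀ a ∈ A, ∀ b ∈ B, ‖inner ℂ a b‖ ≤ (1 - g) / 2 * (‖a‖ ^ 2 + ‖b‖ ^ 2))
    {v : H} (hv : v ∈ A ⊔ B) :
    4 * g * ‖v‖ ^ 2 ≤ ‖v - ((B ⊔ C).reflection * (A ⊔ C).reflection) v‖ ^ 2 := by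
  have hvC : v ∈ Cᗮ := sup_le (a := A) hAC hBC hv
  -- Applying the involution R_B, an isometry, turns v - R_B R_A v into R_B v - R_A v.
  have h1 : ‖v - ((B ⊔ C).reflection * (A ⊔ C).reflection) v‖ =
      2 * ‖A.starProjection v - B.starProjection v‖ := by
    rw [← (B ⊔ C).reflection.norm_map, map_sub, LinearIsometryEquiv.coe_mul, Function.comp_apply,
      Submodule.reflection_reflection, Submodule.reflection_apply, Submodule.reflection_apply,
      starProjection_sup_of_isOrtho hAC hvC, starProjection_sup_of_isOrtho hBC hvC,
      sub_sub_sub_cancel_right, ← smul_sub, norm_sub_rev, two_smul,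
      ← two_smul ℝ, norm_smul, Real.norm_two, norm_sub_rev]
  rw [h1]
  nlinarith [le_norm_sq_starProjection_sub hg0 h hv]

/-- The product of the reflections in `A ⊔ C` and `B ⊔ C` moves a vector far from itself on
average, as measured by its component in `A`, when `A` and `B` form large angles. -/
theorem le_sum_norm_sq_reflection_mul_reflection_pow_sub (hAC : A ⟂ C) (hBC : B ⟂ C) {g : ℝ}
    (hg0 : 0 < g)
    (h : ∀ a ∈ A, ∀ b ∈ B, ‖inner ℂ a b‖ ≤ (1 - g) / 2 * (‖a‖ ^ 2 + ‖b‖ ^ 2))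
    {a φ : H} (ha : a ∈ A) (haφ : inner ℂ a φ = (‖a‖ : ℂ) ^ 2) {n : ℕ} (hn : 2 ≤ n * √g) :
    n * ‖a‖ ^ 2 ≤ ∑ t ∈ Finset.range n,
      ‖(((B ⊔ C).reflection * (A ⊔ C).reflection) ^ t) φ - φ‖ ^ 2 := by
  set U := (B ⊔ C).reflection * (A ⊔ C).reflection with hU
  set ψ := (A ⊔ B).starProjection φ with hψ
  have hψV : ψ ∈ A ⊔ B := (A ⊔ B).starProjection_apply_mem φ
  have hUV : ∀ v ∈ A ⊔ B, U v ∈ A ⊔ B := fun v => reflection_mul_reflection_apply_mem hAC hBC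
  have hlow : ∀ v ∈ A ⊔ B, 2 * √g * ‖v‖ ≤ ‖v - U v‖ := by
    intro v hv
    refine le_of_sq_le_sq ?_ (norm_nonneg _)
    rw [mul_pow, mul_pow, Real.sq_sqrt hg0.le]
    norm_num
    exact le_norm_sq_sub_reflection_mul_reflection hAC hBC hg0.le h hv
  -- 1 - U is injective on the invariant subspace `A ⊔ B` by `hlow`, hence surjective there by
  -- finite dimension.
  obtain ⟨χ, hχV, hχ⟩ : ∃ χ ∈ A ⊔ B, ψ = χ - U χ := by
    let L : (A ⊔ B : Submodule ℂ H) →ₗ[ℂ] (A ⊔ B : Submodule ℂ H) :=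
      LinearMap.id - (U.toLinearEquiv.toLinearMap).restrict hUV
    have hinj : Function.Injective L := by
      rw [injective_iff_map_eq_zero]
      intro v hv
      have h1 : (v : H) - U v = 0 := congrArg Subtype.val hv
      have h2 := hlow v v.2
      rw [h1, norm_zero] at h2
      have : ‖(v : H)‖ ≤ 0 := by
        by_contra! h3
        have : 0 < 2 * √g * ‖(v : H)‖ := by positivity
        linarith
      exact Subtype.ext (norm_le_zero_iff.1 this)
    obtain ⟨χ, hχ⟩ := LinearMap.injective_iff_surjective.1 hinj ⟨ψ, hψV⟩
    exact ⟨χ, χ.2, (congrArg Subtype.val hχ).symm⟩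
  have hf : U (φ - ψ) = φ - ψ := reflection_mul_reflection_apply_of_mem_orthogonal hAC hBC
    ((A ⊔ B).sub_starProjection_mem_orthogonal φ)
  have hmove : ∀ t, (U ^ t) φ - φ = (U ^ t) ψ - ψ := by
    intro t
    have := pow_apply_eq_self U hf t
    rw [map_sub] at this
    rw [sub_eq_sub_iff_sub_eq_sub, this]
  have hn' : 4 * ‖χ‖ ≤ n * ‖χ - U χ‖ := by
    have h1 := mul_le_mul_of_nonneg_left (hlow χ hχV) (Nat.cast_nonneg (α := ℝ) n)
    nlinarith [mul_le_mul_of_nonneg_right hn (norm_nonneg χ)]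
  have haψ : ‖a‖ ≤ ‖ψ‖ := by
    have h1 : inner ℂ a ψ = (‖a‖ : ℂ) ^ 2 := by
      rw [← haφ]
      have := (A ⊔ B).sub_starProjection_mem_orthogonal φ a
        (le_sup_left (a := A) (b := B) ha)
      rw [inner_sub_right, sub_eq_zero] at this
      exact this.symm
    have h2 := norm_inner_le_norm (𝕜 := ℂ) a ψ
    rw [h1, norm_pow, Complex.norm_real, norm_norm] at h2
    by_contra! h3
    nlinarith [norm_nonneg ψ]
  simp only [hmove]
  have h4 := le_sum_norm_sq_pow_apply_sub U hn'
  rw [← hχ] at h4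
  refine le_trans ?_ h4
  gcongr

end Reflections

/-! ### Norm bound for the unmarked block of the transition matrix. -/

section QuadraticForm

open Matrix

variable {X : Type*} [Fintype X]

theorem dotProduct_mulVec_comm_of_isSymm {P : Matrix X X ℝ} (hs : P.IsSymm) (u v : X → ℝ) :
    u ⬝ᵥ P *ᵥ v = v ⬝ᵥ P *ᵥ u := by
  rw [dotProduct_mulVec, ← mulVec_transpose, hs.eq, dotProduct_comm]

/-- A spectral gap on the orthogonal complement of the constants bounds the quadratic form on
vectors vanishing on `M`. -/
theorem dotProduct_mulVec_le_of_eq_zero_on [Nonempty X] {P : Matrix X X ℝ} (h1 : P *ᵥ 1 = 1)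
    (hs : P.IsSymm) {δ : ℝ} (hδ : 0 ≤ δ)
    (hgap : ∀ w : X → ℝ, w ⬝ᵥ 1 = 0 → w ⬝ᵥ P *ᵥ w ≤ (1 - δ) * (w ⬝ᵥ w))
    {M : Finset X} {w : X → ℝ} (hw : ∀ x ∈ M, w x = 0) :
    w ⬝ᵥ P *ᵥ w ≤ (1 - δ * (M.card / Fintype.card X)) * (w ⬝ᵥ w) := by
  classical
  set n : ℝ := (Fintype.card X : ℝ) with hn
  have hn0 : 0 < n := by rw [hn]; exact_mod_cast Fintype.card_pos
  have h11 : (1 : X → ℝ) ⬝ᵥ 1 = n := by simp [dotProduct, hn]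
  set c : ℝ := (w ⬝ᵥ 1) / n with hc
  obtain ⟨v, hv⟩ : ∃ v : X → ℝ, w = v + c • 1 := ⟨w - c • 1, by simp⟩
  have hv1 : v ⬝ᵥ 1 = 0 := by
    have : w ⬝ᵥ 1 = v ⬝ᵥ 1 + c * n := by rw [hv, add_dotProduct, smul_dotProduct, h11, smul_eq_mul]
    rw [hc, div_mul_cancel₀ _ hn0.ne'] at this
    linarith
  have hv1' : 1 ⬝ᵥ v = 0 := by rw [dotProduct_comm, hv1]
  have hq : w ⬝ᵥ P *ᵥ w = v ⬝ᵥ P *ᵥ v + c ^ 2 * n := by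
    have : 1 ⬝ᵥ P *ᵥ v = 0 := by rw [dotProduct_mulVec_comm_of_isSymm hs, h1, hv1]
    rw [hv, mulVec_add, mulVec_smul, h1]
    simp only [add_dotProduct, dotProduct_add, smul_dotProduct, dotProduct_smul, this, hv1, h11,
      smul_eq_mul]
    ring
  have hww : w ⬝ᵥ w = v ⬝ᵥ v + c ^ 2 * n := by
    rw [hv]
    simp only [add_dotProduct, dotProduct_add, smul_dotProduct, dotProduct_smul, hv1, hv1', h11,
      smul_eq_mul]
    ring
  have hcs : (w ⬝ᵥ 1) ^ 2 ≤ (n - M.card) * (w ⬝ᵥ w) := by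
    have e1 : w ⬝ᵥ 1 = ∑ x ∈ Mᶜ, w x := by
      rw [dotProduct_one, ← Finset.sum_add_sum_compl M, Finset.sum_eq_zero hw, zero_add]
    have e2 : w ⬝ᵥ w = ∑ x ∈ Mᶜ, w x ^ 2 := by
      simp only [dotProduct, ← pow_two]
      rw [← Finset.sum_add_sum_compl M, Finset.sum_eq_zero fun x hx => by rw [hw x hx]; simp,
        zero_add]
    have e3 : (Mᶜ.card : ℝ) = n - M.card := by
      rw [Finset.card_compl, Nat.cast_sub (Finset.card_le_univ M)]
    rw [e1, e2, ← e3]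
    exact sq_sum_le_card_mul_sum_sq
  have hc2 : c ^ 2 * n ≤ (1 - M.card / n) * (w ⬝ᵥ w) := by
    have e1 : c ^ 2 * n = (w ⬝ᵥ 1) ^ 2 / n := by rw [hc]; field_simp
    have e2 : (1 - M.card / n) * (w ⬝ᵥ w) = (n - M.card) * (w ⬝ᵥ w) / n := by field_simp
    rw [e1, e2]
    gcongr
  -- The form at w is at most (1 - δ)|v|² + c²n = (1 - δ)|w|² + δc²n, and `hc2` bounds the last
  -- term.
  have := hgap v hv1
  nlinarith [mul_le_mul_of_nonneg_left hc2 hδ]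

/-- For a nonnegative symmetric matrix, a bound on the quadratic form on vectors vanishing on `M`
bounds the bilinear form. -/
theorem dotProduct_mulVec_le_of_nonneg {P : Matrix X X ℝ} (h0 : ∀ x y, 0 ≤ P x y)
    (hs : P.IsSymm) {κ : ℝ} {M : Finset X}
    (hq : ∀ w : X → ℝ, (∀ x ∈ M, w x = 0) → w ⬝ᵥ P *ᵥ w ≤ κ * (w ⬝ᵥ w))
    {u v : X → ℝ} (hu : ∀ x ∈ M, u x = 0) (hv : ∀ x ∈ M, v x = 0) :
    u ⬝ᵥ P *ᵥ v ≤ κ / 2 * (u ⬝ᵥ u + v ⬝ᵥ v) := by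
  have h1 := hq (u + v) fun x hx => by simp [hu x hx, hv x hx]
  -- Polarization needs a lower bound for the form at u - v, while `hq` gives only upper bounds.
  -- Nonnegative entries allow passing to |u - v|.
  have h2 := hq (fun x => |u x - v x|) fun x hx => by simp [hu x hx, hv x hx]
  have h3 : -((u - v) ⬝ᵥ P *ᵥ (u - v)) ≤ (fun x => |u x - v x|) ⬝ᵥ P *ᵥ fun x => |u x - v x| := by
    simp only [dotProduct, mulVec, ← Finset.sum_neg_distrib, Finset.mul_sum]
    refine Finset.sum_le_sum fun x _ => Finset.sum_le_sum fun y _ => ?_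
    calc -((u - v) x * (P x y * (u - v) y)) ≤ |(u x - v x) * (P x y * (u y - v y))| := neg_le_abs _
      _ = _ := by rw [abs_mul, abs_mul, abs_of_nonneg (h0 x y)]
  have h4 : ((fun x => |u x - v x|) ⬝ᵥ fun x => |u x - v x|) = (u - v) ⬝ᵥ (u - v) := by
    simp [dotProduct]
  rw [h4] at h2
  have hvu : v ⬝ᵥ u = u ⬝ᵥ v := dotProduct_comm v u
  simp only [mulVec_add, mulVec_sub, add_dotProduct, dotProduct_add, sub_dotProduct,
    dotProduct_sub, dotProduct_mulVec_comm_of_isSymm hs v u, hvu] at h1 h2 h3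
  linarith

/-- Since the entries are nonnegative, the triangle inequality reduces complex coefficients to their
moduli. -/
theorem norm_sum_conj_mul_le_of_nonneg {P : Matrix X X ℝ} (h0 : ∀ x y, 0 ≤ P x y)
    (hs : P.IsSymm) {κ : ℝ} {M : Finset X}
    (hq : ∀ w : X → ℝ, (∀ x ∈ M, w x = 0) → w ⬝ᵥ P *ᵥ w ≤ κ * (w ⬝ᵥ w))
    {α β : X → ℂ} (hα : ∀ x ∈ M, α x = 0) (hβ : ∀ x ∈ M, β x = 0) :
    ‖∑ x, ∑ y, (starRingEnd ℂ) (α x) * (β y * (P x y : ℂ))‖ ≤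
      κ / 2 * (∑ x, ‖α x‖ ^ 2 + ∑ x, ‖β x‖ ^ 2) := by
  have h := dotProduct_mulVec_le_of_nonneg h0 hs hq (u := fun x => ‖α x‖) (v := fun x => ‖β x‖)
    (fun x hx => by simp [hα x hx]) (fun x hx => by simp [hβ x hx])
  simp only [dotProduct, ← pow_two] at h
  refine le_trans ?_ h
  refine norm_sum_le_of_le _ fun x _ => ?_
  rw [mulVec, dotProduct, Finset.mul_sum]
  refine norm_sum_le_of_le _ fun y _ => le_of_eq ?_
  rw [norm_mul, norm_mul, RCLike.norm_conj, Complex.norm_of_nonneg (h0 x y), mul_comm ‖β y‖]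

end QuadraticForm

theorem norm_sq_sum_smul {X : Type*} [Fintype X] {V : Type*} [NormedAddCommGroup V] [InnerProductSpace ℂ V]
    {f : X → V} (hf : Orthonormal ℂ f) (α : X → ℂ) : ‖∑ x, α x • f x‖ ^ 2 = ∑ x, ‖α x‖ ^ 2 := by
  have h := hf.inner_sum α α Finset.univ
  rw [inner_self_eq_norm_sq_to_K] at h
  simp only [RCLike.conj_mul] at h
  exact_mod_cast h

/-! ### Row and column states, and the hitting time bound. -/

section States

variable {X : Type*} [Fintype X] [DecidableEq X] {P : Matrix X X ℝ}

theorem inner_rowState_rowState (hP : P ∈ Matrix.rowStochastic ℝ X) (x y : X) :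
    inner ℂ (rowState P x) (rowState P y) = if x = y then 1 else 0 := by
  simp only [PiLp.inner_apply, rowState, RCLike.inner_apply, Fintype.sum_prod_type]
  rw [Finset.sum_eq_single y (fun b _ hb => by simp [hb]) (by simp)]
  by_cases h : x = y
  · subst h
    have : ∀ z, ((√(P x z) : ℂ)) * (starRingEnd ℂ) (√(P x z) : ℂ) = (P x z : ℂ) := fun z => by
      rw [Complex.conj_ofReal, ← Complex.ofReal_mul, Real.mul_self_sqrt (hP.1 x z)]
    simp only [if_true, this]
    exact_mod_cast Matrix.sum_row_of_mem_rowStochastic hP x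
  · simp [h, Ne.symm h]

theorem orthonormal_rowState (hP : P ∈ Matrix.rowStochastic ℝ X) : Orthonormal ℂ (rowState P) :=
  orthonormal_iff_ite.2 (inner_rowState_rowState hP)

theorem inner_colState_colState (P : Matrix X X ℝ) (x y : X) :
    inner ℂ (colState P x) (colState P y) = inner ℂ (rowState P x) (rowState P y) := by
  simp only [PiLp.inner_apply, rowState, colState]
  exact Fintype.sum_equiv (Equiv.prodComm X X) _ _ fun z => rfl

theorem orthonormal_colState (hP : P ∈ Matrix.rowStochastic ℝ X) : Orthonormal ℂ (colState P) :=
  orthonormal_iff_ite.2 fun x y => by rw [inner_colState_colState, inner_rowState_rowState hP]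

/-- The supports meet only in (x, y), and symmetry makes the product of the two square roots equal
to the entry. -/
theorem inner_rowState_colState (h0 : ∀ x y, 0 ≤ P x y) (hs : P.IsSymm) (x y : X) :
    inner ℂ (rowState P x) (colState P y) = P x y := by
  simp only [PiLp.inner_apply, rowState, colState, RCLike.inner_apply, Fintype.sum_prod_type]
  rw [Finset.sum_eq_single x (fun b _ hb => by simp [hb]) (by simp),
    Finset.sum_eq_single y (fun b _ hb => by simp [hb]) (by simp)]
  simp only [if_true, Complex.conj_ofReal, ← Complex.ofReal_mul, hs.apply x y,
    Real.mul_self_sqrt (h0 x y)]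

theorem inner_rowState_single {x y : X} (hxy : x ≠ y) :
    inner ℂ (rowState P x) (EuclideanSpace.single (y, y) 1) = 0 := by
  simp [EuclideanSpace.inner_single_right, rowState, hxy.symm]

theorem inner_colState_single {x y : X} (hxy : x ≠ y) :
    inner ℂ (colState P x) (EuclideanSpace.single (y, y) 1) = 0 := by
  simp [EuclideanSpace.inner_single_right, colState, hxy.symm]

theorem rowState_absorbing (P : Matrix X X ℝ) (M : Finset X) (x : X) :
    rowState (absorbing P M) x =
      if x ∈ M then EuclideanSpace.single (x, x) 1 else rowState P x := by
  ext ⟨a, b⟩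
  by_cases hx : x ∈ M
  · by_cases ha : a = x <;> by_cases hb : b = x <;>
      simp [rowState, absorbing, hx, ha, hb, Ne.symm]
  · simp [rowState, absorbing, hx]

theorem colState_absorbing (P : Matrix X X ℝ) (M : Finset X) (x : X) :
    colState (absorbing P M) x =
      if x ∈ M then EuclideanSpace.single (x, x) 1 else colState P x := by
  ext ⟨a, b⟩
  by_cases hx : x ∈ M
  · by_cases ha : a = x <;> by_cases hb : b = x <;>
      simp [colState, absorbing, hx, ha, hb, Ne.symm]
  · simp [colState, absorbing, hx]

/-- The span of the states `|x⟩|x⟩` for marked `x`. -/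
def markedSpace (M : Finset X) : Submodule ℂ (StateSpace X) :=
  Submodule.span ℂ ((fun x => EuclideanSpace.single (x, x) 1) '' (M : Set X))

/-- The span of the row states of unmarked elements. -/
def unmarkedRowSpace (P : Matrix X X ℝ) (M : Finset X) : Submodule ℂ (StateSpace X) :=
  Submodule.span ℂ (rowState P '' (M : Set X)ᶜ)

/-- The span of the column states of unmarked elements. -/
def unmarkedColSpace (P : Matrix X X ℝ) (M : Finset X) : Submodule ℂ (StateSpace X) :=
  Submodule.span ℂ (colState P '' (M : Set X)ᶜ)

theorem range_ite_mem {ι : Type*} [DecidableEq ι] {β : Type*} (M : Finset ι) (f g : ι → β) :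
    Set.range (fun x => if x ∈ M then f x else g x) = g '' (M : Set ι)ᶜ ∪ f '' (M : Set ι) := by
  ext b
  constructor
  · rintro ⟨x, rfl⟩
    by_cases hx : x ∈ M
    · exact Or.inr ⟨x, hx, by simp [hx]⟩
    · exact Or.inl ⟨x, hx, by simp [hx]⟩
  · rintro (⟨x, hx, rfl⟩ | ⟨x, hx, rfl⟩)
    · exact ⟨x, if_neg hx⟩
    · exact ⟨x, if_pos hx⟩

theorem span_rowState_absorbing (P : Matrix X X ℝ) (M : Finset X) :
    Submodule.span ℂ (Set.range (rowState (absorbing P M))) =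
      unmarkedRowSpace P M ⊔ markedSpace M := by
  rw [unmarkedRowSpace, markedSpace, ← Submodule.span_union, ← range_ite_mem]
  exact congrArg _ (congrArg _ (funext (rowState_absorbing P M)))

theorem span_colState_absorbing (P : Matrix X X ℝ) (M : Finset X) :
    Submodule.span ℂ (Set.range (colState (absorbing P M))) =
      unmarkedColSpace P M ⊔ markedSpace M := by
  rw [unmarkedColSpace, markedSpace, ← Submodule.span_union, ← range_ite_mem]
  exact congrArg _ (congrArg _ (funext (colState_absorbing P M)))

theorem walk_absorbing (P : Matrix X X ℝ) (M : Finset X) :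
    walk (absorbing P M) = (unmarkedColSpace P M ⊔ markedSpace M).reflection *
      (unmarkedRowSpace P M ⊔ markedSpace M).reflection := by
  simp_rw [walk, span_rowState_absorbing, span_colState_absorbing]

theorem unmarkedRowSpace_isOrtho (P : Matrix X X ℝ) (M : Finset X) :
    unmarkedRowSpace P M ⟂ markedSpace M := by
  rw [unmarkedRowSpace, markedSpace, Submodule.isOrtho_span]
  rintro _ ⟨x, hx, rfl⟩ _ ⟨y, hy, rfl⟩
  exact inner_rowState_single fun h => hx (h ▸ hy)

theorem unmarkedColSpace_isOrtho (P : Matrix X X ℝ) (M : Finset X) :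
    unmarkedColSpace P M ⟂ markedSpace M := by
  rw [unmarkedColSpace, markedSpace, Submodule.isOrtho_span]
  rintro _ ⟨x, hx, rfl⟩ _ ⟨y, hy, rfl⟩
  exact inner_colState_single fun h => hx (h ▸ hy)

theorem exists_sum_smul_of_mem_span_image_compl {V : Type*} [AddCommGroup V] [Module ℂ V]
    {f : X → V} {M : Finset X} {v : V} (hv : v ∈ Submodule.span ℂ (f '' (M : Set X)ᶜ)) :
    ∃ α : X → ℂ, (∀ x ∈ M, α x = 0) ∧ ∑ x, α x • f x = v := by
  rw [← Finset.coe_compl, Submodule.mem_span_image_finset_iff_exists_fun] at hv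
  obtain ⟨c, hc⟩ := hv
  refine ⟨fun x => if h : x ∈ Mᶜ then c ⟨x, h⟩ else 0, fun x hx => by simp [hx], ?_⟩
  rw [← hc, ← Finset.sum_add_sum_compl M, Finset.sum_eq_zero (fun x hx => by simp [hx]), zero_add,
    ← Finset.sum_coe_sort Mᶜ]
  exact Finset.sum_congr rfl fun x _ => congrArg (· • f x) (dif_pos x.2)

/-- With κ = 1 - g this is the angle condition on `A` and `B` required by the reflection estimates.
-/
theorem norm_inner_le_of_mem_unmarked (hP : P ∈ Matrix.rowStochastic ℝ X) (hs : P.IsSymm)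
    {κ : ℝ} {M : Finset X}
    (hq : ∀ w : X → ℝ, (∀ x ∈ M, w x = 0) → w ⬝ᵥ P.mulVec w ≤ κ * (w ⬝ᵥ w))
    {a b : StateSpace X} (ha : a ∈ unmarkedRowSpace P M) (hb : b ∈ unmarkedColSpace P M) :
    ‖inner ℂ a b‖ ≤ κ / 2 * (‖a‖ ^ 2 + ‖b‖ ^ 2) := by
  obtain ⟨α, hα, rfl⟩ := exists_sum_smul_of_mem_span_image_compl ha
  obtain ⟨β, hβ, rfl⟩ := exists_sum_smul_of_mem_span_image_compl hb
  rw [norm_sq_sum_smul (orthonormal_rowState hP), norm_sq_sum_smul (orthonormal_colState hP)]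
  refine le_trans (le_of_eq ?_) (norm_sum_conj_mul_le_of_nonneg hP.1 hs hq hα hβ)
  simp only [sum_inner, inner_sum, inner_smul_left, inner_smul_right,
    inner_rowState_colState hP.1 hs]
  rw [Finset.sum_comm]
  simp only [mul_left_comm, Finset.mul_sum]

theorem initialState_eq_sum (P : Matrix X X ℝ) :
    initialState P = ∑ x, ((√(Fintype.card X))⁻¹ : ℂ) • rowState P x := by
  ext z
  simp [initialState, rowState, div_eq_inv_mul]

/-- The mean deviation reaches the threshold as soon as `T + 1 ≥ 2 / √g`. -/
theorem le_meanDeviation [Nonempty X] (hP : P ∈ Matrix.rowStochastic ℝ X) (hs : P.IsSymm)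
    {g : ℝ} (hg : 0 < g) {M : Finset X}
    (hq : ∀ w : X → ℝ, (∀ x ∈ M, w x = 0) → w ⬝ᵥ P.mulVec w ≤ (1 - g) * (w ⬝ᵥ w))
    {T : ℕ} (hT : 2 ≤ (T + 1) * √g) :
    1 - (M.card : ℝ) / Fintype.card X ≤ meanDeviation P M T := by
  set s : ℂ := (√(Fintype.card X))⁻¹ with hsdef
  have hn0 : (0 : ℝ) < Fintype.card X := by exact_mod_cast Fintype.card_pos
  set a : StateSpace X := ∑ x, (if x ∈ M then 0 else s) • rowState P x with ha
  have hnorm : ‖a‖ ^ 2 = 1 - (M.card : ℝ) / Fintype.card X := by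
    have hs2 : ‖s‖ ^ 2 = (Fintype.card X : ℝ)⁻¹ := by
      rw [hsdef, norm_inv, Complex.norm_real, Real.norm_eq_abs, inv_pow, sq_abs,
        Real.sq_sqrt hn0.le]
    rw [ha, norm_sq_sum_smul (orthonormal_rowState hP)]
    have : ∀ x, ‖(if x ∈ M then 0 else s)‖ ^ 2 = if x ∈ Mᶜ then (Fintype.card X : ℝ)⁻¹ else 0 := by
      intro x
      by_cases hx : x ∈ M <;> simp [hx, hs2]
    simp only [this]
    rw [Finset.sum_ite_mem, Finset.univ_inter, Finset.sum_const, Finset.card_compl, nsmul_eq_mul,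
      Nat.cast_sub (Finset.card_le_univ M)]
    field_simp
  have hmem : a ∈ unmarkedRowSpace P M := by
    refine Submodule.sum_mem _ fun x _ => ?_
    by_cases hx : x ∈ M
    · simp [hx]
    · exact Submodule.smul_mem _ _ (Submodule.subset_span ⟨x, hx, rfl⟩)
  -- The vector a is the unmarked part of the initial state's expansion in the orthonormal row
  -- states.
  have hinner : inner ℂ a (initialState P) = (‖a‖ : ℂ) ^ 2 := by
    rw [show (‖a‖ : ℂ) ^ 2 = inner ℂ a a from (inner_self_eq_norm_sq_to_K a).symm,
      initialState_eq_sum, ha, (orthonormal_rowState hP).inner_sum,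
      (orthonormal_rowState hP).inner_sum]
    refine Finset.sum_congr rfl fun x _ => ?_
    by_cases hx : x ∈ M <;> simp [hx, hsdef]
  have key := le_sum_norm_sq_reflection_mul_reflection_pow_sub (unmarkedRowSpace_isOrtho P M)
    (unmarkedColSpace_isOrtho P M) hg
    (fun a ha b hb => norm_inner_le_of_mem_unmarked hP hs hq ha hb) hmem hinner
    (n := T + 1) (by exact_mod_cast hT)
  rw [← walk_absorbing, hnorm] at key
  rw [meanDeviation, le_div_iff₀ (by positivity)]
  push_cast at key
  linarith

theorem exists_hittingTime_eq_of_le_meanDeviation {M : Finset X} {T : ℕ}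
    (hT : 1 - (M.card : ℝ) / Fintype.card X ≤ meanDeviation P M T) :
    ∃ S : ℕ, hittingTime P M = S ∧ S ≤ T := by
  have h : hittingTime P M ≤ T := iInf₂_le T hT
  obtain ⟨S, hS⟩ := ENat.ne_top_iff_exists.1 (ne_top_of_le_ne_top (ENat.natCast_ne_top T) h)
  refine ⟨S, hS.symm, ?_⟩
  rw [← hS] at h
  exact_mod_cast h

/-- The quantum hitting time is at most `2 / √(δ ε)` for a chain with spectral gap `δ`. -/
theorem exists_hittingTime_eq [Nonempty X] (hP : P ∈ Matrix.rowStochastic ℝ X) (hs : P.IsSymm)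
    {δ ε : ℝ} (hδ : 0 < δ)
    (hgap : ∀ w : X → ℝ, w ⬝ᵥ 1 = 0 → w ⬝ᵥ P.mulVec w ≤ (1 - δ) * (w ⬝ᵥ w))
    {M : Finset X} (hM : M.Nonempty) (hε : (M.card : ℝ) = ε * Fintype.card X) :
    ∃ T : ℕ, hittingTime P M = T ∧ (T : ℝ) ≤ 2 * √(1 / (δ * ε)) := by
  have hn0 : (0 : ℝ) < Fintype.card X := by exact_mod_cast Fintype.card_pos
  have hεeq : (M.card : ℝ) / Fintype.card X = ε := by rw [hε, mul_div_cancel_right₀ _ hn0.ne']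
  have hε0 : 0 < ε := by
    rw [← hεeq]
    have : (0 : ℝ) < M.card := by exact_mod_cast hM.card_pos
    exact div_pos this hn0
  have hg : 0 < δ * ε := mul_pos hδ hε0
  have hsg : 0 < √(δ * ε) := Real.sqrt_pos.2 hg
  -- The average has T + 1 terms, so the floor suffices and no additive constant appears.
  have hT : 2 ≤ ((⌊2 / √(δ * ε)⌋₊ : ℝ) + 1) * √(δ * ε) := by
    rw [← div_le_iff₀ hsg]
    exact (Nat.lt_floor_add_one _).le
  obtain ⟨S, hS, hST⟩ := exists_hittingTime_eq_of_le_meanDeviation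
    (le_meanDeviation hP hs hg (M := M)
      (fun w hw => hεeq ▸ dotProduct_mulVec_le_of_eq_zero_on hP.2 hs hδ.le hgap hw) hT)
  refine ⟨S, hS, ?_⟩
  calc (S : ℝ) ≤ (⌊2 / √(δ * ε)⌋₊ : ℝ) := by exact_mod_cast hST
    _ ≤ 2 / √(δ * ε) := Nat.floor_le (by positivity)
    _ = 2 * √(1 / (δ * ε)) := by rw [one_div, Real.sqrt_inv, div_eq_mul_inv]

end States

/-! ### Rayleigh quotients and Weyl's inequality for the second eigenvalue. -/

section SecondEigenvalue

open Matrix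

theorem inner_toLp {n : Type*} [Fintype n] (u w : n → ℝ) :
    inner ℝ (WithLp.toLp 2 u : EuclideanSpace ℝ n) (WithLp.toLp 2 w) = u ⬝ᵥ w := by
  simp [EuclideanSpace.inner_eq_star_dotProduct, dotProduct_comm]

theorem norm_toLp_sq {n : Type*} [Fintype n] (w : n → ℝ) :
    ‖(WithLp.toLp 2 w : EuclideanSpace ℝ n)‖ ^ 2 = w ⬝ᵥ w := by
  rw [← inner_toLp, real_inner_self_eq_norm_sq]

/-- The quadratic form of a matrix is bounded by its operator norm. -/
theorem dotProduct_mulVec_le_l2_opNorm {n : Type*} [Fintype n] [DecidableEq n]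
    (E : Matrix n n ℝ) (w : n → ℝ) : w ⬝ᵥ E *ᵥ w ≤ ‖E‖ * (w ⬝ᵥ w) := by
  have h := E.l2_opNorm_mulVec (WithLp.toLp 2 w)
  rw [← inner_toLp, ← norm_toLp_sq w]
  calc _ ≤ ‖(WithLp.toLp 2 w : EuclideanSpace ℝ n)‖ *
        ‖(WithLp.toLp 2 (E *ᵥ w) : EuclideanSpace ℝ n)‖ := real_inner_le_norm _ _
    _ ≤ ‖(WithLp.toLp 2 w : EuclideanSpace ℝ n)‖ *
        (‖E‖ * ‖(WithLp.toLp 2 w : EuclideanSpace ℝ n)‖) := by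
      gcongr
      exact h
    _ = _ := by ring

section Spectral

variable {n : Type*} [Fintype n] [DecidableEq n] {A : Matrix n n ℝ} (hA : A.IsHermitian)

theorem eigenvectorBasis_dotProduct_mulVec (i : n) (w : n → ℝ) :
    (hA.eigenvectorBasis i).ofLp ⬝ᵥ A *ᵥ w =
      hA.eigenvalues i * ((hA.eigenvectorBasis i).ofLp ⬝ᵥ w) := by
  rw [dotProduct_mulVec_comm_of_isSymm (isHermitian_iff_isSymm.1 hA),
    hA.mulVec_eigenvectorBasis, dotProduct_smul, smul_eq_mul, dotProduct_comm]

theorem sum_eigenvectorBasis_dotProduct (u w : n → ℝ) :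
    ∑ i, ((hA.eigenvectorBasis i).ofLp ⬝ᵥ u) * ((hA.eigenvectorBasis i).ofLp ⬝ᵥ w) = u ⬝ᵥ w := by
  rw [← inner_toLp, ← hA.eigenvectorBasis.sum_inner_mul_inner]
  refine Finset.sum_congr rfl fun i _ => ?_
  rw [real_inner_comm, ← WithLp.toLp_ofLp 2 (hA.eigenvectorBasis i), inner_toLp, inner_toLp]

theorem dotProduct_mulVec_eq_sum_eigenvalues (w : n → ℝ) :
    w ⬝ᵥ A *ᵥ w = ∑ i, hA.eigenvalues i * ((hA.eigenvectorBasis i).ofLp ⬝ᵥ w) ^ 2 := by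
  rw [← sum_eigenvectorBasis_dotProduct hA w (A *ᵥ w)]
  refine Finset.sum_congr rfl fun i _ => ?_
  rw [eigenvectorBasis_dotProduct_mulVec]
  ring

theorem dotProduct_self_eq_sum (w : n → ℝ) :
    w ⬝ᵥ w = ∑ i, ((hA.eigenvectorBasis i).ofLp ⬝ᵥ w) ^ 2 := by
  rw [← sum_eigenvectorBasis_dotProduct hA w w]
  simp only [pow_two]

/-- If all eigenvalues but one are less than `1` and `1` is fixed by `A`, the other eigenvalues
bound the quadratic form on the vectors orthogonal to the constants. -/
theorem dotProduct_mulVec_le_of_eigenvalues_le {i₀ : n} {μ : ℝ} (hμ : μ < 1)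
    (hi : ∀ i, i ≠ i₀ → hA.eigenvalues i ≤ μ) (h1 : A *ᵥ 1 = 1) {w : n → ℝ} (hw : w ⬝ᵥ 1 = 0) :
    w ⬝ᵥ A *ᵥ w ≤ μ * (w ⬝ᵥ w) := by
  -- Eigenvectors for eigenvalues other than 1 are orthogonal to the fixed vector 1. Thus 1 is a
  -- multiple of the eigenvector at `i₀`, and w ⟂ 1 forces w to be orthogonal to that eigenvector.
  have hzero : ∀ i, i ≠ i₀ → (hA.eigenvectorBasis i).ofLp ⬝ᵥ (1 : n → ℝ) = 0 := by
    intro i hne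
    have h := eigenvectorBasis_dotProduct_mulVec hA i 1
    rw [h1] at h
    have h2 : (1 - hA.eigenvalues i) * ((hA.eigenvectorBasis i).ofLp ⬝ᵥ (1 : n → ℝ)) = 0 := by
      linarith
    refine (mul_eq_zero.1 h2).resolve_left ?_
    have := hi i hne
    linarith
  have hsum : ∀ u : n → ℝ, ((hA.eigenvectorBasis i₀).ofLp ⬝ᵥ u) *
      ((hA.eigenvectorBasis i₀).ofLp ⬝ᵥ (1 : n → ℝ)) = u ⬝ᵥ 1 := by
    intro u
    rw [← sum_eigenvectorBasis_dotProduct hA u 1]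
    symm
    exact Finset.sum_eq_single i₀ (fun i _ hne => by rw [hzero i hne, mul_zero]) (by simp)
  have hw0 : (hA.eigenvectorBasis i₀).ofLp ⬝ᵥ w = 0 := by
    have h := hsum w
    rw [hw] at h
    refine (mul_eq_zero.1 h).resolve_right fun h0 => ?_
    have h2 := hsum 1
    rw [h0, mul_zero] at h2
    have : (1 : n → ℝ) = 0 := dotProduct_self_eq_zero.1 h2.symm
    simpa using congrFun this i₀
  rw [dotProduct_mulVec_eq_sum_eigenvalues hA, dotProduct_self_eq_sum hA w, Finset.mul_sum]
  refine Finset.sum_le_sum fun i _ => ?_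
  by_cases hne : i = i₀
  · rw [hne, hw0]; simp
  · exact mul_le_mul_of_nonneg_right (hi i hne) (sq_nonneg _)

/-- Among the combinations of two eigenvectors there is one orthogonal to a given vector; its
Rayleigh quotient is at least the smaller eigenvalue. -/
theorem exists_le_dotProduct_mulVec {i j : n} (hij : i ≠ j) {μ : ℝ} (hi : μ ≤ hA.eigenvalues i)
    (hj : μ ≤ hA.eigenvalues j) (u : n → ℝ) :
    ∃ w : n → ℝ, 0 < w ⬝ᵥ w ∧ w ⬝ᵥ u = 0 ∧ μ * (w ⬝ᵥ w) ≤ w ⬝ᵥ A *ᵥ w := by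
  set e := fun k => (hA.eigenvectorBasis k).ofLp with he
  have hee : ∀ k l, e k ⬝ᵥ e l = if k = l then 1 else 0 := by
    intro k l
    rw [← inner_toLp]
    exact orthonormal_iff_ite.1 hA.eigenvectorBasis.orthonormal k l
  obtain ⟨a, b, hab, hu⟩ : ∃ a b : ℝ, 0 < a ^ 2 + b ^ 2 ∧ a * (e i ⬝ᵥ u) + b * (e j ⬝ᵥ u) = 0 := by
    by_cases h : e i ⬝ᵥ u = 0
    · exact ⟨1, 0, by norm_num, by rw [h]; ring⟩
    · exact ⟨e j ⬝ᵥ u, -(e i ⬝ᵥ u), by rw [neg_sq]; positivity, by ring⟩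
  have hAe : ∀ k, A *ᵥ e k = hA.eigenvalues k • e k := hA.mulVec_eigenvectorBasis
  have hww : (a • e i + b • e j) ⬝ᵥ (a • e i + b • e j) = a ^ 2 + b ^ 2 := by
    simp only [add_dotProduct, dotProduct_add, smul_dotProduct, dotProduct_smul, hee, hij,
      hij.symm, if_true, if_false, smul_eq_mul]
    ring
  refine ⟨a • e i + b • e j, by rwa [hww], ?_, ?_⟩
  · simpa only [add_dotProduct, smul_dotProduct, smul_eq_mul] using hu
  · have : (a • e i + b • e j) ⬝ᵥ A *ᵥ (a • e i + b • e j) =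
        hA.eigenvalues i * a ^ 2 + hA.eigenvalues j * b ^ 2 := by
      simp only [mulVec_add, mulVec_smul, hAe, add_dotProduct, dotProduct_add, smul_dotProduct,
        dotProduct_smul, hee, hij, hij.symm, if_true, if_false, smul_eq_mul]
      ring
    rw [hww, this]
    nlinarith [mul_le_mul_of_nonneg_right hi (sq_nonneg a),
      mul_le_mul_of_nonneg_right hj (sq_nonneg b)]

end Spectral

variable {N : ℕ} (hN : 1 < N) {A B : Matrix (Fin N) (Fin N) ℝ}

/-- The eigenvalues other than the first are at most the second one, which is at most the first. -/
theorem exists_eigenvalues_le_secondEigenvalue (hA : A.IsHermitian) :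
    ∃ i j : Fin N, i ≠ j ∧ (∀ k, k ≠ i → hA.eigenvalues k ≤ secondEigenvalue hN hA) ∧
      secondEigenvalue hN hA ≤ hA.eigenvalues i ∧
      secondEigenvalue hN hA ≤ hA.eigenvalues j := by
  let σ : Fin (Fintype.card (Fin N)) ≃ Fin N := Fintype.equivOfCardEq (Fintype.card_fin _)
  have hcard : 1 < Fintype.card (Fin N) := by simpa using hN
  have hσ : ∀ k, hA.eigenvalues (σ k) = hA.eigenvalues₀ k := fun k => by
    simp [IsHermitian.eigenvalues, σ]
  refine ⟨σ ⟨0, by lia⟩, σ ⟨1, hcard⟩, fun h => ?_, fun k hk => ?_, ?_, ?_⟩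
  · simpa using σ.injective h
  · obtain ⟨l, rfl⟩ := σ.surjective k
    rw [hσ]
    refine hA.eigenvalues₀_antitone (Fin.mk_le_of_le_val ?_)
    by_contra h
    exact hk (congrArg σ (Fin.ext (by simp; lia)))
  · rw [hσ]
    exact hA.eigenvalues₀_antitone (by simp)
  · rw [hσ]; rfl

theorem dotProduct_mulVec_le_of_secondEigenvalue_le (hA : A.IsHermitian) (h1 : A *ᵥ 1 = 1)
    {δ : ℝ} (hδ : 0 < δ) (h : secondEigenvalue hN hA ≤ 1 - δ) {w : Fin N → ℝ} (hw : w ⬝ᵥ 1 = 0) :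
    w ⬝ᵥ A *ᵥ w ≤ (1 - δ) * (w ⬝ᵥ w) := by
  obtain ⟨i, -, -, hi, -⟩ := exists_eigenvalues_le_secondEigenvalue hN hA
  exact dotProduct_mulVec_le_of_eigenvalues_le hA (by linarith)
    (fun k hk => (hi k hk).trans h) h1 hw

/-- Weyl's inequality for the second eigenvalue of symmetric stochastic matrices. -/
theorem secondEigenvalue_le_of_secondEigenvalue_le (hA : A.IsHermitian) (hB : B.IsHermitian)
    (h1 : A *ᵥ 1 = 1) {δ : ℝ} (hδ : 0 < δ) (h : secondEigenvalue hN hA ≤ 1 - δ) :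
    secondEigenvalue hN hB ≤ 1 - δ + ‖B - A‖ := by
  obtain ⟨i, j, hij, -, hi, hj⟩ := exists_eigenvalues_le_secondEigenvalue hN hB
  -- As w lies in the span of two top eigenvectors of `B` and is orthogonal to the constants, its
  -- Rayleigh quotient is at least λ₂(B) for `B` and at most 1 - δ for `A`.
  obtain ⟨w, hw0, hw1, hw⟩ := exists_le_dotProduct_mulVec hB hij hi hj 1
  refine le_of_mul_le_mul_right ?_ hw0
  have e1 := dotProduct_mulVec_le_of_secondEigenvalue_le hN hA h1 hδ h hw1
  have e2 := dotProduct_mulVec_le_l2_opNorm (B - A) w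
  rw [sub_mulVec, dotProduct_sub] at e2
  linarith

end SecondEigenvalue

end QuantumWalk

theorem corollary2 :
    ∃ C : ℝ, 0 < C ∧
      ∀ (N : ℕ) (hN : 1 < N) (P Q E : Matrix (Fin N) (Fin N) ℝ)
        (hP : QuantumWalk.IsSymmErgodicChain P) (hQ : QuantumWalk.IsSymmErgodicChain Q)
        (_ : Q = P + E) (M : Finset (Fin N)) (_ : M.Nonempty)
        (ε δ Δ : ℝ) (_ : (M.card : ℝ) = ε * N) (_ : 0 < δ)
        (_ : QuantumWalk.secondEigenvalue hN hP.isHermitian ≤ 1 - δ)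
        (_ : QuantumWalk.secondEigenvalue hN hQ.isHermitian ≤ 1 - Δ),
        (∃ T : ℕ, QuantumWalk.hittingTime P M = T ∧ (T : ℝ) ≤ C * √(1 / (δ * ε))) ∧
        (‖E‖ < δ →
          ∃ T : ℕ, QuantumWalk.hittingTime Q M = T ∧ (T : ℝ) ≤ C * √(1 / ((δ - ‖E‖) * ε))) ∧
        (QuantumWalk.secondEigenvalue hN hQ.isHermitian = 1 - Δ → δ - ‖E‖ ≤ Δ) ∧
        (QuantumWalk.secondEigenvalue hN hP.isHermitian = 1 - δ → Δ ≤ δ + ‖E‖) := by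
  refine ⟨2, two_pos, ?_⟩
  intro N hN P Q E hP hQ hE M hM ε δ Δ hε hδ hPδ hQΔ
  have : Nonempty (Fin N) := ⟨⟨0, by lia⟩⟩
  have hε' : (M.card : ℝ) = ε * Fintype.card (Fin N) := by rw [hε, Fintype.card_fin]
  have hQP : Q - P = E := by rw [hE, add_sub_cancel_left]
  have hweyl : QuantumWalk.secondEigenvalue hN hQ.isHermitian ≤ 1 - δ + ‖E‖ := hQP ▸
    QuantumWalk.secondEigenvalue_le_of_secondEigenvalue_le hN hP.isHermitian hQ.isHermitian
      hP.stochastic.2 hδ hPδ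
  refine ⟨?_, fun hlt => ?_, fun h => by linarith, fun h => ?_⟩
  · exact QuantumWalk.exists_hittingTime_eq hP.stochastic hP.symm hδ
      (fun w hw => QuantumWalk.dotProduct_mulVec_le_of_secondEigenvalue_le hN hP.isHermitian
        hP.stochastic.2 hδ hPδ hw) hM hε'
  · exact QuantumWalk.exists_hittingTime_eq hQ.stochastic hQ.symm (sub_pos.2 hlt)
      (fun w hw => QuantumWalk.dotProduct_mulVec_le_of_secondEigenvalue_le hN hQ.isHermitian
        hQ.stochastic.2 (sub_pos.2 hlt) (by linarith) hw) hM hε'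
  -- Weyl's inequality with `Q` as the base chain needs a positive gap; for Δ ≤ 0 the claim follows
  -- from δ > 0.
  · rcases le_or_gt Δ 0 with hΔ | hΔ
    · linarith [norm_nonneg E]
    · have h2 := QuantumWalk.secondEigenvalue_le_of_secondEigenvalue_le hN hQ.isHermitian
        hP.isHermitian hQ.stochastic.2 hΔ hQΔ
      rw [norm_sub_rev, hQP] at h2
      linarith
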